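/- Let $N\ge 1$ and let $e^{i\theta_1},\dots,e^{i\theta_N}$ be the eigenvalues of the circular orthogonal ensemble (COE, $\beta=1$), with joint density $$\frac1{Z_N}\prod_{1\le j<k\le N}\bigl|e^{i\theta_j}-e^{i\theta_k}\bigr|^{\beta},\qquad \beta=1,$$ with respect to $\prod_j d\theta_j/2\pi$, where $Z_N$ is the normalisation. Let $\rho_{(1)}$ and $\rho_{(2)}$ be the one- and two-point correlation functions, i.e. $N$, respectively $N(N-1)$, times the integral of the joint density over the remaining $N-1$, respectively $N-2$, angles with respect to $d\theta/2\pi$ each (so $\rho_{(2)}=0$ if $N=1$). Put $\rho_{(2)C}(\theta_1,\theta_2)=\rho_{(2)}(\theta_1,\theta_2)-\rho_{(1)}(\theta_1)\rho_{(1)}(\theta_2)$, which depends only on $\theta=\theta_2-\theta_1$, and let $$m_k=\int_0^{2\pi}\frac{d\theta}{2\pi}\,e^{-ik\theta}\rho_{(2)C}(\theta),\qquad k\in\mathbb Z,$$ be its Fourier coefficients. Let $\psi=\Gamma'/\Gamma$ be the digamma function, and $x\,\Theta(x)=\max(x,0)$. Then: 1. $m_0=-N$. For $k\ge 1$, $$m_k=-(N-|k|)\Theta(N-|k|)+\min(k,N)-k\Bigl[\psi\bigl(\tfrac12(N+1)+k\bigr)-\psi\bigl(\tfrac12(N+1)+\max(0,k-N)\bigr)\Bigr],$$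 and for $k\le -1$, $$m_k=-(N-|k|)\Theta(N-|k|)+\min(-k,N)+k\Bigl[\psi\bigl(\tfrac12(N+1)-k\bigr)-\psi\bigl(\tfrac12(N+1)+\max(0,-k-N)\bigr)\Bigr].$$ 2. If $N\ge2$, then $m_k\ne0$ for every $k\in\mathbb Z$. 3. For $1\le k\le N+1$, $$m_k=-N+2k-2k\sum_{j=1}^{k}\frac1{N+2j-1}.$$ -/

import Mathlib

open Real MeasureTheory

noncomputable section

namespace CircularEnsemble

/-- The period `2π` is positive. -/
instance twoPiPos : Fact (0 < 2 * π) := ⟨Real.two_pi_pos⟩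

/-- An angle, i.e. an element of `ℝ / 2πℤ`. -/
abbrev Angle : Type := AddCircle (2 * π)

/-- The unnormalised eigenvalue density `∏_{j<k} |e^{iθ_j} - e^{iθ_k}|^β` of the circular
`β` ensemble with `n` eigenvalues `e^{iθ_1}, …, e^{iθ_n}`. -/
def weight (β : ℝ) {n : ℕ} (θ : Fin n → Angle) : ℝ :=
  ∏ j : Fin n, ∏ k ∈ Finset.Ioi j,
    ‖((θ j).toCircle : ℂ) - ((θ k).toCircle : ℂ)‖ ^ β

/-- The product of `n` copies of the normalised measure `dθ / 2π = dζ / (2πiζ)`. -/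
def torusMeasure (n : ℕ) : Measure (Fin n → Angle) :=
  Measure.pi fun _ => AddCircle.haarAddCircle

/-- The normalisation `Z_N`. -/
def partitionFunction (β : ℝ) (N : ℕ) : ℝ :=
  ∫ θ : Fin N → Angle, weight β θ ∂torusMeasure N

/-- The eigenvalue density `ρ_(1)(θ₁)` with respect to `dθ₁ / 2π`. It is meant for `N ≥ 1`, where
`N - 1` is the number of angles that are integrated out. -/
def rho1 (β : ℝ) (N : ℕ) (θ₁ : Angle) : ℝ :=
  (N : ℝ) / partitionFunction β N *
    ∫ φ : Fin (N - 1) → Angle, weight β (Fin.cons θ₁ φ : Fin (N - 1 + 1) → Angle)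
      ∂torusMeasure (N - 1)

/-- The two-point correlation function `ρ_(2)(θ₁, θ₂)` with respect to `dθ₁ dθ₂ / (2π)²`; for
`N ≥ 2`, `N - 2` is the number of angles that are integrated out. For `N = 1` the prefactor
`N (N - 1)` makes it zero, as it should be. -/
def rho2 (β : ℝ) (N : ℕ) (θ₁ θ₂ : Angle) : ℝ :=
  (N : ℝ) * ((N : ℝ) - 1) / partitionFunction β N *
    ∫ φ : Fin (N - 2) → Angle,
      weight β (Fin.cons θ₁ (Fin.cons θ₂ φ : Fin (N - 2 + 1) → Angle) : Fin (N - 2 + 1 + 1) → Angle)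
      ∂torusMeasure (N - 2)

/-- The connected two-point correlation function
`ρ_(2)C(θ₁, θ₂) = ρ_(2)(θ₁, θ₂) - ρ_(1)(θ₁) ρ_(1)(θ₂)`. -/
def rho2C (β : ℝ) (N : ℕ) (θ₁ θ₂ : Angle) : ℝ :=
  rho2 β N θ₁ θ₂ - rho1 β N θ₁ * rho1 β N θ₂

/-- The moment `m_k`: the `k`-th Fourier coefficient of `ρ_(2)C` as a function of the difference
`θ = θ₂ - θ₁`, that is `m_k = ∫ e^{-ikθ} ρ_(2)C(0, θ) dθ / 2π`. -/
def moment (β : ℝ) (N : ℕ) (k : ℤ) : ℂ :=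
  fourierCoeff (fun θ : Angle => (rho2C β N 0 θ : ℂ)) k

lemma weight_add_const (β : ℝ) {n : ℕ} (c : Angle) (θ : Fin n → Angle) :
    weight β (fun i => c + θ i) = weight β θ := by
  unfold weight
  refine Finset.prod_congr rfl fun j _ => Finset.prod_congr rfl fun k _ => ?_
  rw [AddCircle.toCircle_add, AddCircle.toCircle_add, Circle.coe_mul, Circle.coe_mul, ← mul_sub,
    norm_mul, Circle.norm_coe, one_mul]

lemma integral_add_const {n : ℕ} (c : Angle) (f : (Fin n → Angle) → ℝ) :
    ∫ φ, f (fun i => c + φ i) ∂torusMeasure n = ∫ φ, f φ ∂torusMeasure n := by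
  unfold torusMeasure
  exact integral_add_left_eq_self f (fun _ => c)

/-- Rotation invariance: `ρ_(2)C` depends only on the difference of the angles, so that the
moments are the Fourier coefficients of `ρ_(2)C(θ₁, θ₂)` in `θ = θ₂ - θ₁` for every `θ₁`. -/
lemma rho2C_eq (β : ℝ) (N : ℕ) (θ₁ θ₂ : Angle) :
    rho2C β N θ₁ θ₂ = rho2C β N 0 (θ₂ - θ₁) := by
  have h1 : ∀ c x : Angle, rho1 β N (c + x) = rho1 β N x := by
    intro c x
    unfold rho1
    rw [← integral_add_const c]
    congr 2
    funext φ
    rw [← weight_add_const β c (Fin.cons x φ)]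
    congr 1
    funext i
    refine Fin.cases ?_ (fun i => ?_) i <;> simp
  have h2 : ∀ c x y : Angle, rho2 β N (c + x) (c + y) = rho2 β N x y := by
    intro c x y
    unfold rho2
    rw [← integral_add_const c]
    congr 2
    funext φ
    rw [← weight_add_const β c (Fin.cons x (Fin.cons y φ))]
    congr 1
    funext i
    refine Fin.cases ?_ (fun i => Fin.cases ?_ (fun i => ?_) i) i <;> simp
  have e1 := h1 θ₁ 0
  have e2 := h1 θ₁ (θ₂ - θ₁)
  have e3 := h2 θ₁ 0 (θ₂ - θ₁)
  rw [add_zero] at e1 e3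
  rw [add_sub_cancel] at e2 e3
  unfold rho2C
  rw [e1, e2, e3]

end CircularEnsemble

end

noncomputable section

namespace CircularEnsemble

/-!
For `β = 1` the weight is, up to a constant, the product of `sign (θ_j - θ_k)` over `j < k` and of
the Vandermonde determinant in the plane waves `e^{iqθ}` whose frequencies `q = a - (N - 1) / 2`
are symmetric about zero. Multiplying it by `e^{ik(θ_j - θ_l)}` moves `k` units of frequency from
`l` to `j`, so `m_k` is a sum over `j` and `l` of ratios of integrals of such products.

To evaluate them, integrate out the angle `j` by parts. At its frequency `q` the product of signs
times `e^{iqθ}` is periodic, so only the jumps at the other angles contribute; they put the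
frequency `q` on another angle and square the signs there, and integrating that angle out leaves
the pairs of frequencies that add up to zero. This is the expansion along a row of the Pfaffian in
de Bruijn's formula. For fixed `j`, either `q + k` is again one of the frequencies, and only the
transposition contributes `-1`, or `q + k` is too large, and only `l` with frequency `-q`
contributes `q / (q + k)`.
-/

/-! ### Products of signs -/

lemma measurable_sign : Measurable Real.sign :=
  Measurable.ite measurableSet_Iio measurable_const
    (Measurable.ite measurableSet_Ioi measurable_const measurable_const)

lemma abs_sign_le_one (x : ℝ) : |x.sign| ≤ 1 := by
  rcases Real.sign_apply_eq x with h | h | h <;> simp [h]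

lemma sign_mul_self {x : ℝ} (hx : x ≠ 0) : x.sign * x.sign = 1 := by
  rcases Real.sign_apply_eq_of_ne_zero x hx with h | h <;> simp [h]

lemma sign_mul_sign {u v : ℝ} (hu : u ≠ 0) (hv : v ≠ 0) :
    u.sign * v.sign = 1 + (u - v).sign * (v.sign - u.sign) := by
  rcases hu.lt_or_gt with hu | hu <;> rcases hv.lt_or_gt with hv | hv
  · simp [Real.sign_of_neg, hu, hv]
  · simp [Real.sign_of_neg hu, Real.sign_of_pos hv, Real.sign_of_neg (by linarith : u - v < 0)]
  · simp [Real.sign_of_pos hu, Real.sign_of_neg hv, Real.sign_of_pos (by linarith : 0 < u - v)]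
  · simp [Real.sign_of_pos, hu, hv]

section SignProduct

variable {ι : Type*} [DecidableEq ι] {s : Finset ι} {x : ι → ℝ}

/-- As a function of `t`, the product is locally constant with jumps at the points `x c`. -/
lemma prod_sign_sub {t : ℝ} (hx : Set.InjOn x s) (ht : ∀ c ∈ s, t ≠ x c) :
    ∏ c ∈ s, (t - x c).sign = (-1) ^ s.card +
      ∑ c ∈ s, (∏ d ∈ s.erase c, (x c - x d).sign) * (1 + (t - x c).sign) := by
  induction s using Finset.induction_on generalizing t with
  | empty => simp
  | insert e s he ih =>
    have hxs : Set.InjOn x s := hx.mono (by simp)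
    have hne : ∀ c ∈ s, x e ≠ x c := fun c hc h =>
      he (hx (by simp) (by simp [hc]) h ▸ hc)
    have hts : ∀ c ∈ s, t ≠ x c := fun c hc => ht c (by simp [hc])
    have hjump : ∀ c ∈ s, (t - x e).sign * (t - x c).sign =
        1 + (x c - x e).sign * ((t - x c).sign - (t - x e).sign) := fun c hc => by
      simpa using sign_mul_sign (sub_ne_zero.2 (ht e (by simp))) (sub_ne_zero.2 (hts c hc))
    have hanti : ∀ c, (x e - x c).sign = -(x c - x e).sign := fun c => by
      rw [← Real.sign_neg, neg_sub]
    have herase : ∀ c ∈ s, ∏ d ∈ (insert e s).erase c, (x c - x d).sign =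
        (x c - x e).sign * ∏ d ∈ s.erase c, (x c - x d).sign := fun c hc => by
      rw [Finset.erase_insert_of_ne (by rintro rfl; exact he hc),
        Finset.prod_insert (by simp [he])]
    rw [Finset.prod_insert he, Finset.sum_insert he, Finset.erase_insert he, ih hxs hts,
      ih hxs hne, Finset.card_insert_of_notMem he, add_mul, Finset.sum_mul, mul_add,
      Finset.mul_sum, add_assoc, ← Finset.sum_add_distrib,
      Finset.sum_congr rfl fun c _ => show _ = (∏ d ∈ s.erase c, (x c - x d).sign) *
        ((t - x e).sign + (t - x e).sign * (t - x c).sign) by ring,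
      Finset.sum_congr rfl fun c hc => show (∏ d ∈ s.erase c, (x c - x d).sign) *
        (1 + (x e - x c).sign) * (1 + (t - x e).sign) + _ =
          (∏ d ∈ s.erase c, (x c - x d).sign) *
            ((t - x e).sign + (t - x e).sign * (t - x c).sign) by
        rw [herase c hc, hjump c hc, hanti c]; ring]
    ring

lemma two_mul_sum_prod_sign_sub (hx : Set.InjOn x s) :
    2 * ∑ c ∈ s, ∏ d ∈ s.erase c, (x c - x d).sign = 1 - (-1) ^ s.card := by
  obtain ⟨t, ht⟩ : ∃ t, ∀ c ∈ s, x c < t := by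
    obtain ⟨M, hM⟩ := (s.image x).bddAbove
    exact ⟨M + 1, fun c hc => (hM (by simpa using ⟨c, hc, rfl⟩)).trans_lt (lt_add_one M)⟩
  have hsign : ∀ c ∈ s, (t - x c).sign = 1 := fun c hc =>
    Real.sign_of_pos (sub_pos.2 (ht c hc))
  have hprod := prod_sign_sub hx fun c hc => (ht c hc).ne'
  rw [Finset.prod_eq_one hsign, Finset.sum_congr rfl fun c hc => by rw [hsign c hc],
    ← Finset.sum_mul] at hprod
  linarith

variable {a b : ℝ} {f F : ℝ → ℂ}

lemma intervalIntegrable_mul_one_add_sign (hf : Continuous f) (y : ℝ) :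
    IntervalIntegrable (fun t => f t * ((1 + (t - y).sign : ℝ) : ℂ)) volume a b := by
  have hmeas : Measurable fun t => ((1 + (t - y).sign : ℝ) : ℂ) := Complex.measurable_ofReal.comp
    (measurable_const.add (measurable_sign.comp (measurable_id.sub_const y)))
  have hbound : ∀ t, ‖((1 + (t - y).sign : ℝ) : ℂ)‖ ≤ 1 + 1 := fun t => by
    rw [Complex.norm_real]
    exact (norm_add_le _ _).trans (add_le_add norm_one.le (abs_sign_le_one _))
  have hfab := hf.intervalIntegrable (μ := volume) a b
  exact ⟨hfab.1.mul_bdd hmeas.aestronglyMeasurable (.of_forall hbound),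
    hfab.2.mul_bdd hmeas.aestronglyMeasurable (.of_forall hbound)⟩

lemma integral_mul_one_add_sign {y : ℝ} (hy : y ∈ Set.Icc a b) (hf : Continuous f)
    (hF : ∀ t, HasDerivAt F (f t) t) :
    ∫ t in a..b, f t * ((1 + (t - y).sign : ℝ) : ℂ) = 2 * (F b - F y) := by
  have hleft : ∫ t in a..y, f t * ((1 + (t - y).sign : ℝ) : ℂ) = 0 := by
    rw [intervalIntegral.integral_congr_Ioo_of_le (g := fun _ => 0) hy.1 fun t ht => by
      simp [Real.sign_of_neg (sub_neg.2 ht.2)]]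
    simp
  have hright : ∫ t in y..b, f t * ((1 + (t - y).sign : ℝ) : ℂ) = 2 * (F b - F y) := by
    rw [intervalIntegral.integral_congr_Ioo_of_le (g := fun t => 2 * f t) hy.2 fun t ht => by
      simp [Real.sign_of_pos (sub_pos.2 ht.1)]; ring, intervalIntegral.integral_const_mul,
      intervalIntegral.integral_eq_sub_of_hasDerivAt (fun t _ => hF t)
        (hf.intervalIntegrable y b)]
  rw [← intervalIntegral.integral_add_adjacent_intervals
    (intervalIntegrable_mul_one_add_sign hf y) (intervalIntegrable_mul_one_add_sign hf y),
    hleft, hright, zero_add]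

lemma integral_mul_prod_sign (hx : Set.InjOn x s) (hab : ∀ c ∈ s, x c ∈ Set.Icc a b)
    (hf : Continuous f) (hF : ∀ t, HasDerivAt F (f t) t) :
    ∫ t in a..b, f t * ((∏ c ∈ s, (t - x c).sign : ℝ) : ℂ) =
      F b - (-1) ^ s.card * F a -
        2 * ∑ c ∈ s, ((∏ d ∈ s.erase c, (x c - x d).sign : ℝ) : ℂ) * F (x c) := by
  set ε : ι → ℝ := fun c => ∏ d ∈ s.erase c, (x c - x d).sign with hε
  have hexpand : ∀ᵐ t, f t * ((∏ c ∈ s, (t - x c).sign : ℝ) : ℂ) =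
      (-1) ^ s.card * f t + ∑ c ∈ s, (ε c : ℂ) * (f t * ((1 + (t - x c).sign : ℝ) : ℂ)) := by
    filter_upwards [(s.image x).finite_toSet.countable.ae_notMem volume] with t ht
    rw [prod_sign_sub hx fun c hc h => ht (by simpa using ⟨c, hc, h.symm⟩)]
    push_cast
    rw [mul_add, mul_comm, Finset.mul_sum]
    congr 1
    exact Finset.sum_congr rfl fun c _ => by simp only [hε]; push_cast; ring
  have hsum : 2 * ∑ c ∈ s, (ε c : ℂ) = 1 - (-1) ^ s.card := by
    exact_mod_cast congrArg (Complex.ofReal) (two_mul_sum_prod_sign_sub hx)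
  have hint : ∀ c ∈ s, IntervalIntegrable
      (fun t => (ε c : ℂ) * (f t * ((1 + (t - x c).sign : ℝ) : ℂ))) volume a b := fun c _ =>
    (intervalIntegrable_mul_one_add_sign hf (x c)).const_mul _
  rw [intervalIntegral.integral_congr_ae (hexpand.mono fun t ht _ => ht),
    intervalIntegral.integral_add ((hf.intervalIntegrable a b).const_mul _)
      (by simpa only [Finset.sum_fn] using IntervalIntegrable.sum s hint),
    intervalIntegral.integral_finsetSum hint, intervalIntegral.integral_const_mul,
    intervalIntegral.integral_eq_sub_of_hasDerivAt (fun t _ => hF t) (hf.intervalIntegrable a b),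
    Finset.sum_congr rfl fun c hc => by
      rw [intervalIntegral.integral_const_mul, integral_mul_one_add_sign (hab c hc) hf hF]]
  have hjumps : ∑ c ∈ s, (ε c : ℂ) * (2 * (F b - F (x c))) =
      (2 * ∑ c ∈ s, (ε c : ℂ)) * F b - 2 * ∑ c ∈ s, (ε c : ℂ) * F (x c) := by
    rw [Finset.mul_sum, Finset.mul_sum, Finset.sum_mul, ← Finset.sum_sub_distrib]
    exact Finset.sum_congr rfl fun c _ => by ring
  rw [hjumps, hsum]
  ring

end SignProduct

/-! ### Plane waves on the circle -/

/-- The product of the signs of `x j - x k` over `j < k`: the sign of the permutation that sorts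
`x` in decreasing order, and zero if `x` has a repeated entry. -/
def orderSign {n : ℕ} (x : Fin n → ℝ) : ℝ :=
  ∏ j : Fin n, ∏ k ∈ Finset.Ioi j, (x j - x k).sign

lemma orderSign_comp_perm {n : ℕ} (x : Fin n → ℝ) (σ : Equiv.Perm (Fin n)) :
    orderSign (x ∘ σ) = ((Equiv.Perm.sign σ : ℤ) : ℝ) * orderSign x := by
  simpa [orderSign] using σ.prod_Ioi_comp_eq_sign_mul_prod (f := fun j k => (x j - x k).sign)
    fun j k => by rw [← Real.sign_neg, neg_sub]

lemma orderSign_cons {n : ℕ} (t : ℝ) (x : Fin n → ℝ) :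
    orderSign (Fin.cons t x : Fin (n + 1) → ℝ) = (∏ c, (t - x c).sign) * orderSign x := by
  simp [orderSign, Fin.prod_univ_succ, Fin.prod_Ioi_succ]

lemma orderSign_insertNth {n : ℕ} (a : Fin (n + 1)) (t : ℝ) (x : Fin n → ℝ) :
    orderSign (a.insertNth t x : Fin (n + 1) → ℝ) =
      (-1) ^ (a : ℕ) * (∏ c, (t - x c).sign) * orderSign x := by
  rw [← Fin.cons_comp_cycleRange, orderSign_comp_perm, orderSign_cons, Fin.sign_cycleRange,
    mul_assoc]
  simp

lemma orderSign_eq_zero {n : ℕ} {x : Fin n → ℝ} (hx : ¬ Function.Injective x) :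
    orderSign x = 0 := by
  obtain ⟨a, b, hab, hne⟩ := Function.not_injective_iff.1 hx
  wlog hlt : a < b generalizing a b
  · exact this b a hab.symm hne.symm (hne.lt_or_gt.resolve_left hlt)
  exact Finset.prod_eq_zero (Finset.mem_univ a)
    (Finset.prod_eq_zero (Finset.mem_Ioi.2 hlt) (by simp [hab]))

lemma abs_orderSign_le_one {n : ℕ} (x : Fin n → ℝ) : |orderSign x| ≤ 1 := by
  simp only [orderSign, Finset.abs_prod]
  exact Finset.prod_le_one (fun _ _ => Finset.prod_nonneg fun _ _ => abs_nonneg _)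
    fun _ _ => Finset.prod_le_one (fun _ _ => abs_nonneg _) fun _ _ => abs_sign_le_one _

lemma measurable_orderSign {n : ℕ} : Measurable (orderSign : (Fin n → ℝ) → ℝ) :=
  Finset.measurable_fun_prod _ fun j _ => Finset.measurable_fun_prod _ fun k _ =>
    measurable_sign.comp ((measurable_pi_apply j).sub (measurable_pi_apply k))

/-- The representative in `(0, 2π]` of an angle. -/
def rep (x : Angle) : ℝ := (AddCircle.equivIoc (2 * π) 0 x : ℝ)

lemma measurable_rep : Measurable rep :=
  measurable_subtype_coe.comp (AddCircle.measurableEquivIoc (2 * π) 0).measurable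

lemma rep_mem_Ioc (x : Angle) : rep x ∈ Set.Ioc 0 (2 * π) := by
  simpa [rep] using (AddCircle.equivIoc (2 * π) 0 x).2

lemma coe_rep (x : Angle) : ((rep x : ℝ) : Angle) = x :=
  AddCircle.coe_equivIoc

lemma rep_injective : Function.Injective rep := Function.LeftInverse.injective coe_rep

lemma rep_coe {t : ℝ} (ht : t ∈ Set.Ioc 0 (2 * π)) : rep (t : Angle) = t := by
  rw [rep, AddCircle.equivIoc_coe_eq (by simpa using ht)]

/-- The function `e^{iqθ}` of the representative `θ ∈ (0, 2π]` of an angle, for any real `q`. -/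
def planeWave (q : ℝ) (x : Angle) : ℂ := Complex.exp (Complex.I * q * rep x)

lemma measurable_planeWave (q : ℝ) : Measurable (planeWave q) :=
  Complex.measurable_exp.comp ((Complex.measurable_ofReal.comp measurable_rep).const_mul _)

lemma norm_planeWave (q : ℝ) (x : Angle) : ‖planeWave q x‖ = 1 := by
  simp [planeWave, Complex.norm_exp]

lemma planeWave_zero (x : Angle) : planeWave 0 x = 1 := by simp [planeWave]

lemma planeWave_add (p q : ℝ) (x : Angle) :
    planeWave (p + q) x = planeWave p x * planeWave q x := by
  simp only [planeWave, ← Complex.exp_add]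
  push_cast
  ring_nf

lemma fourier_eq_planeWave (k : ℤ) (x : Angle) : fourier k x = planeWave k x := by
  conv_lhs => rw [← coe_rep x]
  rw [fourier_coe_apply, planeWave]
  congr 1
  push_cast
  field_simp

lemma toCircle_eq_planeWave (x : Angle) : (x.toCircle : ℂ) = planeWave 1 x := by
  simpa using fourier_eq_planeWave 1 x

lemma integral_comp_rep (f : ℝ → ℂ) :
    ∫ x, f (rep x) ∂AddCircle.haarAddCircle = (2 * π : ℂ)⁻¹ * ∫ t in (0 : ℝ)..2 * π, f t := by
  rw [AddCircle.integral_haarAddCircle, ← AddCircle.intervalIntegral_preimage (2 * π) 0, zero_add,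
    Complex.real_smul]
  push_cast
  congr 1
  refine intervalIntegral.integral_congr_Ioo_of_le Real.two_pi_pos.le fun t ht => ?_
  simp only [rep_coe (Set.Ioo_subset_Ioc_self ht)]

lemma integral_fourier (k : ℤ) :
    ∫ x : Angle, fourier k x ∂AddCircle.haarAddCircle = if k = 0 then 1 else 0 := by
  simpa [fourierCoeff, Pi.single_apply, eq_comm] using
    congrFun (fourierCoeff_fourier (T := 2 * π) k) 0

lemma integral_planeWave_intCast (k : ℤ) :
    ∫ x, planeWave k x ∂AddCircle.haarAddCircle = if k = 0 then 1 else 0 := by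
  simp only [← fourier_eq_planeWave, integral_fourier]

/-- With the boundary condition `hp` on the interval `[0, 2π]`, only the jumps contribute. -/
lemma integral_planeWave_mul_prod_sign {n : ℕ} {p : ℝ} (hp0 : p ≠ 0)
    (hp : Complex.exp (Complex.I * p * (2 * π)) = (-1) ^ n) {φ : Fin n → Angle}
    (hφ : Function.Injective φ) :
    ∫ t, planeWave p t * ((∏ c, (rep t - rep (φ c)).sign : ℝ) : ℂ) ∂AddCircle.haarAddCircle =
      Complex.I / (π * p) * ∑ c, ((∏ d ∈ Finset.univ.erase c,
        (rep (φ c) - rep (φ d)).sign : ℝ) : ℂ) * planeWave p (φ c) := by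
  have hpI : Complex.I * p ≠ 0 :=
    mul_ne_zero Complex.I_ne_zero (Complex.ofReal_ne_zero.2 hp0)
  have hF (t : ℝ) : HasDerivAt (fun t : ℝ => Complex.exp (Complex.I * p * t) / (Complex.I * p))
      (Complex.exp (Complex.I * p * t)) t := by
    simpa [hpI] using
      ((hasDerivAt_id (t : ℂ)).const_mul (Complex.I * p)).cexp.comp_ofReal.div_const (Complex.I * p)
  unfold planeWave
  rw [integral_comp_rep fun t => Complex.exp (Complex.I * p * t) *
      ((∏ c, (t - rep (φ c)).sign : ℝ) : ℂ),
    integral_mul_prod_sign (x := fun c => rep (φ c)) (rep_injective.comp hφ).injOn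
      (fun c _ => Set.Ioc_subset_Icc_self (rep_mem_Ioc _)) (by fun_prop) hF]
  push_cast
  rw [hp, Finset.card_univ, Fintype.card_fin]
  simp only [mul_zero, Complex.exp_zero, mul_div_assoc', ← Finset.sum_div,
    mul_one, sub_self, zero_sub]
  have : (p : ℂ) ≠ 0 := Complex.ofReal_ne_zero.2 hp0
  have hpi : (π : ℂ) ≠ 0 := Complex.ofReal_ne_zero.2 Real.pi_ne_zero
  field_simp
  simp [Complex.I_sq]

/-! ### Ordered integrals of plane waves -/

instance (n : ℕ) : IsProbabilityMeasure (torusMeasure n) := by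
  unfold torusMeasure
  infer_instance

lemma integral_comp_perm {n : ℕ} {E : Type*} [NormedAddCommGroup E] [NormedSpace ℝ E]
    (σ : Equiv.Perm (Fin n)) (f : (Fin n → Angle) → E) :
    ∫ θ, f (θ ∘ σ) ∂torusMeasure n = ∫ θ, f θ ∂torusMeasure n :=
  (measurePreserving_arrowCongr' (fun _ => AddCircle.haarAddCircle)
    (fun _ => AddCircle.haarAddCircle) σ.symm (.refl Angle)
    fun _ => .id _).integral_comp' f

section Fubini

variable {n : ℕ} {E : Type*} [NormedAddCommGroup E] [NormedSpace ℝ E]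

lemma measurePreserving_insertNth (a : Fin (n + 1)) :
    MeasurePreserving (MeasurableEquiv.piFinSuccAbove (fun _ => Angle) a).symm
      (AddCircle.haarAddCircle.prod (torusMeasure n)) (torusMeasure (n + 1)) :=
  (measurePreserving_piFinSuccAbove (fun _ => AddCircle.haarAddCircle) a).symm

lemma integral_insertNth {f : (Fin (n + 1) → Angle) → E} (a : Fin (n + 1))
    (hf : Integrable f (torusMeasure (n + 1))) :
    ∫ θ, f θ ∂torusMeasure (n + 1) =
      ∫ t, ∫ φ, f (a.insertNth t φ) ∂torusMeasure n ∂AddCircle.haarAddCircle :=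
  ((measurePreserving_insertNth a).integral_comp' f).symm.trans
    (integral_prod _ ((measurePreserving_insertNth a).integrable_comp_of_integrable hf))

lemma integral_insertNth_symm {f : (Fin (n + 1) → Angle) → E} (a : Fin (n + 1))
    (hf : Integrable f (torusMeasure (n + 1))) :
    ∫ θ, f θ ∂torusMeasure (n + 1) =
      ∫ φ, ∫ t, f (a.insertNth t φ) ∂AddCircle.haarAddCircle ∂torusMeasure n :=
  ((measurePreserving_insertNth a).integral_comp' f).symm.trans
    (integral_prod_symm _ ((measurePreserving_insertNth a).integrable_comp_of_integrable hf))

end Fubini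

/-- The product of the plane waves with frequencies `q a` in the angles `θ a`, times the sign of
the ordering of the angles. -/
def orderedWave {n : ℕ} (q : Fin n → ℝ) (θ : Fin n → Angle) : ℂ :=
  (orderSign (rep ∘ θ) : ℂ) * ∏ a, planeWave (q a) (θ a)

/-- The integral of `orderedWave q` over the torus. -/
def orderedIntegral {n : ℕ} (q : Fin n → ℝ) : ℂ :=
  ∫ θ, orderedWave q θ ∂torusMeasure n

lemma measurable_orderedWave {n : ℕ} (q : Fin n → ℝ) : Measurable (orderedWave q) :=
  (Complex.measurable_ofReal.comp (measurable_orderSign.comp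
    (measurable_pi_lambda _ fun a => measurable_rep.comp (measurable_pi_apply a)))).mul
    (Finset.measurable_fun_prod _ fun a _ => (measurable_planeWave _).comp (measurable_pi_apply a))

lemma norm_orderedWave_le_one {n : ℕ} (q : Fin n → ℝ) (θ : Fin n → Angle) :
    ‖orderedWave q θ‖ ≤ 1 := by
  simpa [orderedWave, norm_prod, norm_planeWave] using abs_orderSign_le_one (rep ∘ θ)

lemma integrable_orderedWave {n : ℕ} (q : Fin n → ℝ) :
    Integrable (orderedWave q) (torusMeasure n) :=
  .of_bound (measurable_orderedWave q).aestronglyMeasurable 1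
    (.of_forall (norm_orderedWave_le_one q))

lemma orderedWave_comp_perm {n : ℕ} (q : Fin n → ℝ) (θ : Fin n → Angle)
    (σ : Equiv.Perm (Fin n)) :
    orderedWave (q ∘ σ) (θ ∘ σ) = ((Equiv.Perm.sign σ : ℤ) : ℂ) * orderedWave q θ := by
  simp only [orderedWave, ← Function.comp_assoc, orderSign_comp_perm, Function.comp_apply]
  rw [Equiv.prod_comp σ fun a => planeWave (q a) (θ a)]
  push_cast
  ring

lemma orderedIntegral_comp_perm {n : ℕ} (q : Fin n → ℝ) (σ : Equiv.Perm (Fin n)) :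
    orderedIntegral (q ∘ σ) = ((Equiv.Perm.sign σ : ℤ) : ℂ) * orderedIntegral q := by
  rw [orderedIntegral, orderedIntegral, ← integral_const_mul, ← integral_comp_perm σ]
  simp only [orderedWave_comp_perm]

lemma orderedIntegral_eq_zero {n : ℕ} {q : Fin n → ℝ} (hq : ¬ Function.Injective q) :
    orderedIntegral q = 0 := by
  obtain ⟨a, b, hab, hne⟩ := Function.not_injective_iff.1 hq
  have hswap : q ∘ Equiv.swap a b = q := by
    rw [Equiv.comp_swap_eq_update, hab, Function.update_eq_self, ← hab, Function.update_eq_self]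
  have := orderedIntegral_comp_perm q (Equiv.swap a b)
  rw [hswap, Equiv.Perm.sign_swap hne] at this
  push_cast at this
  linear_combination (1 / 2 : ℂ) * this

lemma comp_insertNth {α β : Type*} {n : ℕ} (f : α → β) (a : Fin (n + 1)) (t : α)
    (x : Fin n → α) :
    f ∘ (a.insertNth t x : Fin (n + 1) → α) = a.insertNth (f t) (f ∘ x) := by
  ext i
  cases i using Fin.succAboveCases a <;> simp

lemma orderedWave_insertNth {n : ℕ} (q : Fin (n + 1) → ℝ) (a : Fin (n + 1)) (t : Angle)
    (φ : Fin n → Angle) :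
    orderedWave q (a.insertNth t φ) = (-1) ^ (a : ℕ) *
      (planeWave (q a) t * ((∏ c, (rep t - rep (φ c)).sign : ℝ) : ℂ)) *
        orderedWave (q ∘ a.succAbove) φ := by
  rw [orderedWave, orderedWave, comp_insertNth, orderSign_insertNth, Fin.prod_univ_succAbove _ a]
  simp only [Fin.insertNth_apply_same, Fin.insertNth_apply_succAbove, Function.comp_apply]
  push_cast
  ring

lemma integral_planeWave_mul_prod_sign_sq {n : ℕ} (p : ℝ) (x : Fin n → ℝ) :
    ∫ t, planeWave p t * ((∏ c, (rep t - x c).sign : ℝ) : ℂ) ^ 2 ∂AddCircle.haarAddCircle =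
      ∫ t, planeWave p t ∂AddCircle.haarAddCircle := by
  unfold planeWave
  rw [integral_comp_rep fun t => Complex.exp (Complex.I * p * t) *
      ((∏ c, (t - x c).sign : ℝ) : ℂ) ^ 2,
    integral_comp_rep fun t => Complex.exp (Complex.I * p * t)]
  congr 1
  refine intervalIntegral.integral_congr_ae ?_
  filter_upwards [(Set.countable_range x).ae_notMem volume] with t ht _
  have hsign : ∀ c, (t - x c).sign ^ 2 = 1 := fun c => by
    rw [sq, sign_mul_self (sub_ne_zero.2 fun h => ht ⟨c, h.symm⟩)]
  rw [← Complex.ofReal_pow, ← Finset.prod_pow, Finset.prod_eq_one fun c _ => hsign c,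
    Complex.ofReal_one, mul_one]

/-- The integrand of one term of the row expansion: the angle `φ c` at which the product of signs
jumps carries the frequency `p` of the angle that has been integrated out. -/
def jumpWave {n : ℕ} (p : ℝ) (q : Fin n → ℝ) (c : Fin n) (φ : Fin n → Angle) : ℂ :=
  ((∏ d ∈ Finset.univ.erase c, (rep (φ c) - rep (φ d)).sign : ℝ) : ℂ) * planeWave p (φ c) *
    orderedWave q φ

lemma integrable_jumpWave {n : ℕ} (p : ℝ) (q : Fin n → ℝ) (c : Fin n) :
    Integrable (jumpWave p q c) (torusMeasure n) := by
  have hrep (d : Fin n) : Measurable fun φ : Fin n → Angle => rep (φ d) :=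
    measurable_rep.comp (measurable_pi_apply d)
  refine (integrable_orderedWave q).bdd_mul (c := 1) (Measurable.aestronglyMeasurable ?_)
    (.of_forall fun φ => ?_)
  · exact (Complex.measurable_ofReal.comp <| Finset.measurable_fun_prod _ fun d _ =>
      measurable_sign.comp ((hrep c).sub (hrep d))).mul
        ((measurable_planeWave p).comp (measurable_pi_apply c))
  · rw [norm_mul, norm_planeWave, mul_one, Complex.norm_real, norm_prod]
    exact Finset.prod_le_one (fun _ _ => norm_nonneg _) fun _ _ => abs_sign_le_one _

lemma jumpWave_insertNth {n : ℕ} (p : ℝ) (q : Fin (n + 1) → ℝ) (c : Fin (n + 1)) (t : Angle)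
    (z : Fin n → Angle) :
    jumpWave p q c (c.insertNth t z) = (-1) ^ (c : ℕ) *
      (planeWave (p + q c) t * ((∏ d, (rep t - rep (z d)).sign : ℝ) : ℂ) ^ 2) *
        orderedWave (q ∘ c.succAbove) z := by
  rw [jumpWave, orderedWave_insertNth, planeWave_add, ← Finset.compl_singleton,
    ← Fin.image_succAbove_univ, Finset.prod_image fun _ _ _ _ h => Fin.succAbove_right_injective h]
  simp only [Fin.insertNth_apply_same, Fin.insertNth_apply_succAbove]
  ring

lemma integral_jumpWave {n : ℕ} (p : ℝ) (q : Fin (n + 1) → ℝ) (c : Fin (n + 1)) :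
    ∫ φ, jumpWave p q c φ ∂torusMeasure (n + 1) =
      (-1) ^ (c : ℕ) * (∫ t, planeWave (p + q c) t ∂AddCircle.haarAddCircle) *
        orderedIntegral (q ∘ c.succAbove) := by
  rw [integral_insertNth_symm c (integrable_jumpWave p q c)]
  simp only [jumpWave_insertNth, integral_mul_const, integral_const_mul,
    integral_planeWave_mul_prod_sign_sq _ fun _ => rep _]
  rw [orderedIntegral]

lemma integral_orderedWave_insertNth {n : ℕ} {q : Fin (n + 1) → ℝ} {a : Fin (n + 1)}
    (ha0 : q a ≠ 0) (ha : Complex.exp (Complex.I * q a * (2 * π)) = (-1) ^ n)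
    (φ : Fin n → Angle) :
    ∫ t, orderedWave q (a.insertNth t φ) ∂AddCircle.haarAddCircle =
      (-1) ^ (a : ℕ) * (Complex.I / (π * q a)) *
        ∑ c, jumpWave (q a) (q ∘ a.succAbove) c φ := by
  simp only [orderedWave_insertNth, jumpWave, integral_mul_const, integral_const_mul]
  by_cases hφ : Function.Injective φ
  · rw [integral_planeWave_mul_prod_sign ha0 ha hφ, ← Finset.sum_mul]
    ring
  · have : orderedWave (q ∘ a.succAbove) φ = 0 := by
      rw [orderedWave, orderSign_eq_zero fun h => hφ h.of_comp]
      simp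
    simp [this]

/-- `orderedIntegral` is a Pfaffian; this is its expansion along the row of `a`. -/
lemma orderedIntegral_row_expansion {n : ℕ} {q : Fin (n + 2) → ℝ} {a : Fin (n + 2)}
    (ha0 : q a ≠ 0) (ha : Complex.exp (Complex.I * q a * (2 * π)) = (-1) ^ (n + 1)) :
    orderedIntegral q = (-1) ^ (a : ℕ) * (Complex.I / (π * q a)) * ∑ c : Fin (n + 1),
      (-1) ^ (c : ℕ) * (∫ t, planeWave (q a + q (a.succAbove c)) t ∂AddCircle.haarAddCircle) *
        orderedIntegral (q ∘ a.succAbove ∘ c.succAbove) := by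
  rw [orderedIntegral, integral_insertNth_symm a (integrable_orderedWave q)]
  simp only [integral_orderedWave_insertNth ha0 ha]
  rw [integral_const_mul, integral_finsetSum _ fun c _ => integrable_jumpWave _ _ c]
  simp only [integral_jumpWave]
  rfl

/-! ### Shifts of the Vandermonde frequencies -/

/-- The frequency `z - (N - 1) / 2`; for `z = 0, …, N - 1` these are the frequencies in the
Vandermonde determinant of `N` points of the circle, centred at zero. -/
def frequency (N : ℕ) (z : ℤ) : ℝ := z - (N - 1) / 2

lemma frequency_succ_add_frequency_succ (n : ℕ) (z w : ℤ) :
    frequency (n + 1) z + frequency (n + 1) w = ((z + w - n : ℤ) : ℝ) := by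
  simp [frequency]
  ring

lemma frequency_ne_zero {n : ℕ} {z : ℤ} (hz : 2 * z ≠ n) : frequency (n + 1) z ≠ 0 := fun h => by
  have := frequency_succ_add_frequency_succ n z z
  rw [h, add_zero, eq_comm, Int.cast_eq_zero] at this
  omega

lemma exp_frequency_succ (n : ℕ) (z : ℤ) :
    Complex.exp (Complex.I * frequency (n + 1) z * (2 * π)) = (-1) ^ n := by
  have hsplit : Complex.I * frequency (n + 1) z * (2 * π) =
      z * (2 * π * Complex.I) - n * (π * Complex.I) := by
    simp [frequency]
    ring
  rw [hsplit, Complex.exp_sub, Complex.exp_int_mul_two_pi_mul_I, Complex.exp_nat_mul,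
    Complex.exp_pi_mul_I, one_div, ← inv_pow, inv_neg_one]

lemma frequency_mul_orderedIntegral {n : ℕ} (c : Fin (n + 2) → ℤ) {a : Fin (n + 2)}
    (ha : 2 * c a ≠ n + 1) :
    frequency (n + 2) (c a) * orderedIntegral (frequency (n + 2) ∘ c) =
      (-1) ^ (a : ℕ) * (Complex.I / π) * ∑ j : Fin (n + 1), (-1) ^ (j : ℕ) *
        (if c a + c (a.succAbove j) = n + 1 then
          orderedIntegral (frequency (n + 2) ∘ c ∘ a.succAbove ∘ j.succAbove) else 0) := by
  have ha0 : (frequency (n + 2) (c a) : ℂ) ≠ 0 :=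
    Complex.ofReal_ne_zero.2 (frequency_ne_zero (n := n + 1) (by exact_mod_cast ha))
  have hwave (j : Fin (n + 1)) : ∫ t, planeWave (frequency (n + 2) (c a) +
      frequency (n + 2) (c (a.succAbove j))) t ∂AddCircle.haarAddCircle =
        if c a + c (a.succAbove j) = n + 1 then 1 else 0 := by
    simp only [frequency_succ_add_frequency_succ (n + 1), integral_planeWave_intCast,
      sub_eq_zero, Nat.cast_add_one]
  rw [orderedIntegral_row_expansion (by exact_mod_cast ha0) (exp_frequency_succ (n + 1) (c a))]
  simp only [Function.comp_apply, hwave, mul_ite, ite_mul, mul_one, mul_zero, zero_mul,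
    Function.comp_assoc]
  field_simp

lemma orderedIntegral_eq_zero_of_unpaired {n : ℕ} {c : Fin (n + 2) → ℤ} {a : Fin (n + 2)}
    (ha : ∀ b, c a + c b ≠ n + 1) : orderedIntegral (frequency (n + 2) ∘ c) = 0 := by
  have ha' : 2 * c a ≠ n + 1 := two_mul (c a) ▸ ha a
  have h := frequency_mul_orderedIntegral c ha'
  simp only [ha, if_false, mul_zero, Finset.sum_const_zero, mul_eq_zero,
    Complex.ofReal_eq_zero] at h
  exact h.resolve_left (frequency_ne_zero (n := n + 1) (by exact_mod_cast ha'))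

/-- Only the term `b` of the row expansion along `a` survives, on both sides. -/
lemma frequency_mul_orderedIntegral_congr {n : ℕ} {c c' : Fin (n + 2) → ℤ} {a b : Fin (n + 2)}
    (hab : a ≠ b) (hc : ∀ i, c a + c i = n + 1 ↔ i = b) (hc' : ∀ i, c' a + c' i = n + 1 ↔ i = b)
    (hcc' : ∀ i, i ≠ a → i ≠ b → c i = c' i) :
    frequency (n + 2) (c a) * orderedIntegral (frequency (n + 2) ∘ c) =
      frequency (n + 2) (c' a) * orderedIntegral (frequency (n + 2) ∘ c') := by
  rw [frequency_mul_orderedIntegral c (two_mul (c a) ▸ (hc a).not.2 hab),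
    frequency_mul_orderedIntegral c' (two_mul (c' a) ▸ (hc' a).not.2 hab)]
  congr 1
  refine Finset.sum_congr rfl fun j _ => ?_
  simp only [hc, hc']
  split_ifs with hj
  · congr 3
    ext i
    exact hcc' _ (a.succAbove_ne _) fun h =>
      j.succAbove_ne i (Fin.succAbove_right_injective (h.trans hj.symm))
  · rfl

/-- The indices `0, …, N - 1`, with `k` units moved from the entry `b` to the entry `a`. -/
def shift {N : ℕ} (k : ℤ) (a b : Fin N) (i : Fin N) : ℤ :=
  i + (if i = a then k else 0) - (if i = b then k else 0)

section Shift

variable {N k : ℕ} {a b : Fin N}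

lemma orderedIntegral_shift_swap {a' : Fin N} (hk : k ≠ 0) (ha' : (a' : ℕ) = a + k) :
    orderedIntegral (frequency N ∘ shift k a a') =
      -orderedIntegral (frequency N ∘ ((↑) : Fin N → ℤ)) := by
  have hne : a ≠ a' := fun h => hk (by simpa [h] using ha')
  have hswap : shift k a a' = (((↑) : Fin N → ℤ)) ∘ Equiv.swap a a' := by
    ext i
    rcases eq_or_ne i a with rfl | hia
    · simp [shift, hne, ha']
    rcases eq_or_ne i a' with rfl | hia'
    · simp [shift, hne.symm, ha']
    · simp [shift, hia, hia', Equiv.swap_apply_of_ne_of_ne]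
  rw [hswap, ← Function.comp_assoc, orderedIntegral_comp_perm, Equiv.Perm.sign_swap hne]
  simp

lemma orderedIntegral_shift_of_collision {a' : Fin N} (hk : k ≠ 0) (ha' : (a' : ℕ) = a + k)
    (hab : a ≠ b) (hb : b ≠ a') : orderedIntegral (frequency N ∘ shift k a b) = 0 := by
  have hne : a' ≠ a := fun h => hk (by simpa [h] using ha')
  refine orderedIntegral_eq_zero fun h => hne (h ?_)
  simp [shift, hne, hab, hb.symm, ha']

lemma orderedIntegral_shift_of_unpaired (hk : N ≤ a + k) (hab : a ≠ b) (hb : b ≠ a.rev) :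
    orderedIntegral (frequency N ∘ shift k a b) = 0 := by
  have hb' := Fin.val_ne_of_ne hb
  have hab' := Fin.val_ne_of_ne hab
  obtain ⟨n, rfl⟩ : ∃ n, N = n + 2 := Nat.exists_eq_add_of_le' (by omega)
  rw [Fin.val_rev] at hb'
  refine orderedIntegral_eq_zero_of_unpaired (a := a) fun i => ?_
  simp only [shift, if_true, hab, if_false]
  split_ifs <;> omega

lemma frequency_mul_orderedIntegral_shift_rev (hk : N ≤ a + k) (ha : a.rev ≠ a) :
    frequency N (a + k) * orderedIntegral (frequency N ∘ shift k a a.rev) =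
      frequency N a * orderedIntegral (frequency N ∘ ((↑) : Fin N → ℤ)) := by
  have hrev := a.val_rev
  have ha' := Fin.val_ne_of_ne ha
  obtain ⟨n, rfl⟩ : ∃ n, N = n + 2 := Nat.exists_eq_add_of_le' (by omega)
  have hshift : shift k a a.rev a = a + k := by simp [shift, ha.symm]
  rw [← hshift]
  refine frequency_mul_orderedIntegral_congr (c := shift k a a.rev) (c' := (↑)) ha.symm
    (fun i => ?_) (fun i => ?_) fun i hi hi' => by simp [shift, hi, hi']
  · rw [hshift]
    simp only [shift, Fin.ext_iff]
    split_ifs <;> omega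
  · rw [Fin.ext_iff]
    omega

end Shift

/-- The contribution to the moment `m_k`, `k ≥ 1`, of the shifts that move `k` units to the entry
`a`. -/
def rowMoment (N k a : ℕ) : ℝ :=
  if a + k < N then -1 else frequency N a / frequency N (a + k)

lemma sum_orderedIntegral_shift {N k : ℕ} (hk : k ≠ 0) (a : Fin N) :
    ∑ b ∈ Finset.univ.erase a, orderedIntegral (frequency N ∘ shift k a b) =
      rowMoment N k a * orderedIntegral (frequency N ∘ ((↑) : Fin N → ℤ)) := by
  by_cases hak : (a : ℕ) + k < N
  · have hne : (⟨a + k, hak⟩ : Fin N) ≠ a := fun h => hk (by simpa using congrArg Fin.val h)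
    rw [Finset.sum_eq_single_of_mem ⟨a + k, hak⟩ (by simp [hne]) fun b hb hb' =>
      orderedIntegral_shift_of_collision hk rfl (Finset.ne_of_mem_erase hb).symm hb',
      orderedIntegral_shift_swap hk rfl]
    simp [rowMoment, hak]
  rw [rowMoment, if_neg hak]
  rw [not_lt] at hak
  by_cases ha : a.rev = a
  · have hzero : frequency N a = 0 := by
      have h2 : 2 * (a : ℕ) + 1 = N := by
        have := a.val_rev
        rw [ha] at this
        omega
      have h2' : 2 * (a : ℝ) + 1 = N := by exact_mod_cast h2
      rw [frequency]
      push_cast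
      linarith
    rw [hzero, Finset.sum_eq_zero fun b hb => orderedIntegral_shift_of_unpaired hak
      (Finset.ne_of_mem_erase hb).symm (ha.symm ▸ Finset.ne_of_mem_erase hb)]
    simp
  · have hpos : 0 < frequency N (a + k) := by
      have : ((N : ℕ) : ℝ) ≤ a + k := by exact_mod_cast hak
      simp only [frequency]
      push_cast
      linarith [(Nat.cast_nonneg N : (0 : ℝ) ≤ N)]
    rw [Finset.sum_eq_single_of_mem a.rev (by simp [ha]) fun b hb hb' =>
      orderedIntegral_shift_of_unpaired hak (Finset.ne_of_mem_erase hb).symm hb',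
      Complex.ofReal_div, div_mul_eq_mul_div, eq_div_iff (by exact_mod_cast hpos.ne'), mul_comm,
      frequency_mul_orderedIntegral_shift_rev hak ha]

/-! ### Moments for general `β` -/

section Weight

variable {β : ℝ} {n : ℕ}

lemma weight_eq_norm_rpow (β : ℝ) (θ : Fin n → Angle) :
    weight β θ = ‖∏ j, ∏ k ∈ Finset.Ioi j,
      (((θ j).toCircle : ℂ) - ((θ k).toCircle : ℂ))‖ ^ β := by
  simp only [weight, norm_prod]
  rw [← Real.finsetProd_rpow _ _ fun j _ => Finset.prod_nonneg fun k _ => norm_nonneg _]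
  exact Finset.prod_congr rfl fun j _ => Real.finsetProd_rpow _ _ (fun k _ => norm_nonneg _) β

lemma weight_comp_perm (β : ℝ) (θ : Fin n → Angle) (σ : Equiv.Perm (Fin n)) :
    weight β (θ ∘ σ) = weight β θ := by
  have hsign : ‖(((Equiv.Perm.sign σ : ℤ) : ℂ))‖ = 1 := by
    rcases Int.units_eq_one_or (Equiv.Perm.sign σ) with h | h <;> simp [h]
  have hperm := σ.prod_Ioi_comp_eq_sign_mul_prod
    (f := fun j k => ((θ j).toCircle : ℂ) - ((θ k).toCircle : ℂ)) fun j k => (neg_sub _ _).symm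
  simp only [weight_eq_norm_rpow, Function.comp_apply]
  rw [hperm, norm_mul, hsign, one_mul]

lemma continuous_weight (hβ : 0 ≤ β) : Continuous (weight β : (Fin n → Angle) → ℝ) := by
  have hcircle (j : Fin n) : Continuous fun θ : Fin n → Angle => ((θ j).toCircle : ℂ) :=
    continuous_subtype_val.comp (AddCircle.continuous_toCircle.comp (continuous_apply j))
  exact continuous_finsetProd _ fun j _ => continuous_finsetProd _ fun k _ =>
    ((hcircle j).sub (hcircle k)).norm.rpow_const fun _ => .inr hβ

lemma weight_nonneg (β : ℝ) (θ : Fin n → Angle) : 0 ≤ weight β θ :=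
  weight_eq_norm_rpow β θ ▸ Real.rpow_nonneg (norm_nonneg _) β

lemma weight_pos (β : ℝ) {θ : Fin n → Angle} (hθ : Function.Injective θ) : 0 < weight β θ :=
  Finset.prod_pos fun _ _ => Finset.prod_pos fun _ hk => Real.rpow_pos_of_pos
    (norm_sub_pos_iff.2 fun h => (Finset.mem_Ioi.1 hk).ne
      (hθ (AddCircle.injective_toCircle Real.two_pi_pos.ne' (Subtype.ext h)))) β

instance (n : ℕ) : (torusMeasure n).IsOpenPosMeasure := by
  unfold torusMeasure
  infer_instance

lemma partitionFunction_pos (hβ : 0 ≤ β) (N : ℕ) : 0 < partitionFunction β N := by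
  have : Infinite (Set.Ioc 0 (0 + 2 * π)) := Set.infinite_coe_iff.2
    (Set.Ioc_infinite (by simp [Real.pi_pos]))
  let θ : Fin N → Angle := fun j =>
    (AddCircle.equivIoc (2 * π) 0).symm (Infinite.natEmbedding (Set.Ioc 0 (0 + 2 * π)) j)
  have hθ : Function.Injective θ := (AddCircle.equivIoc (2 * π) 0).symm.injective.comp
    ((Infinite.natEmbedding _).injective.comp Fin.val_injective)
  exact (continuous_weight hβ).integral_pos_of_hasCompactSupport_nonneg_nonzero
    (.of_compactSpace _) (weight_nonneg β) (weight_pos β hθ).ne'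

lemma weight_cons_add (β : ℝ) (x : Angle) (φ : Fin n → Angle) :
    weight β (Fin.cons x (fun i => x + φ i) : Fin (n + 1) → Angle) =
      weight β (Fin.cons 0 φ : Fin (n + 1) → Angle) := by
  rw [← weight_add_const β x (Fin.cons 0 φ)]
  congr 1
  ext i
  cases i using Fin.cases <;> simp

lemma integral_sub_mul_weight (hβ : 0 ≤ β) {f : (Fin n → Angle) → ℂ} (hf : Continuous f) :
    ∫ θ : Fin (n + 1) → Angle, f (fun i => θ i.succ - θ 0) * (weight β θ : ℂ)
        ∂torusMeasure (n + 1) =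
      ∫ φ, f φ * (weight β (Fin.cons 0 φ : Fin (n + 1) → Angle) : ℂ) ∂torusMeasure n := by
  have hint : Integrable (fun θ : Fin (n + 1) → Angle =>
      f (fun i => θ i.succ - θ 0) * (weight β θ : ℂ)) (torusMeasure (n + 1)) :=
    ((hf.comp (by fun_prop)).mul (Complex.continuous_ofReal.comp
      (continuous_weight hβ))).integrable_of_hasCompactSupport (.of_compactSpace _)
  rw [integral_insertNth 0 hint]
  simp only [Fin.insertNth_zero', Fin.cons_zero, Fin.cons_succ]
  have hrotate (x : Angle) : ∫ φ : Fin n → Angle, f (fun i => φ i - x) *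
      (weight β (Fin.cons x φ : Fin (n + 1) → Angle) : ℂ) ∂torusMeasure n =
        ∫ φ, f φ * (weight β (Fin.cons 0 φ : Fin (n + 1) → Angle) : ℂ) ∂torusMeasure n := by
    rw [torusMeasure, ← integral_add_left_eq_self _ (fun _ => x)]
    simp only [Pi.add_def, add_sub_cancel_left, weight_cons_add]
  simp [hrotate]

lemma rho1_eq (hβ : 0 ≤ β) (N : ℕ) (x : Angle) : rho1 β N x = N := by
  rcases N with _ | n
  · simp [rho1]
  have hZ : partitionFunction β (n + 1) =
      ∫ φ, weight β (Fin.cons x φ : Fin (n + 1) → Angle) ∂torusMeasure n := by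
    have h := integral_sub_mul_weight (n := n) hβ (f := fun _ => 1) continuous_const
    simp only [one_mul, integral_complex_ofReal] at h
    rw [partitionFunction, Complex.ofReal_injective h,
      ← integral_add_const x fun φ => weight β (Fin.cons x φ : Fin (n + 1) → Angle)]
    simp only [weight_cons_add]
  change ((n + 1 : ℕ) : ℝ) / partitionFunction β (n + 1) *
    ∫ φ, weight β (Fin.cons x φ : Fin (n + 1) → Angle) ∂torusMeasure n = _
  rw [← hZ, div_mul_cancel₀ _ (partitionFunction_pos hβ _).ne']

lemma rho2_add_two (β : ℝ) (n : ℕ) (x y : Angle) :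
    rho2 β (n + 2) x y = (n + 2) * (n + 1) / partitionFunction β (n + 2) *
      ∫ φ, weight β (Fin.cons x (Fin.cons y φ : Fin (n + 1) → Angle) : Fin (n + 2) → Angle)
        ∂torusMeasure n := by
  have hn : ((n + 2 : ℕ) : ℝ) * ((n + 2 : ℕ) - 1) = (n + 2) * (n + 1) := by
    push_cast
    ring
  rw [← hn]
  rfl

lemma continuous_rho2 (hβ : 0 ≤ β) (N : ℕ) : Continuous (rho2 β N 0) := by
  have hcons : Continuous (Function.uncurry fun (x : Angle) (φ : Fin (N - 2) → Angle) => weight β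
      (Fin.cons 0 (Fin.cons x φ : Fin (N - 2 + 1) → Angle) : Fin (N - 2 + 1 + 1) → Angle)) :=
    (continuous_weight hβ).comp (continuous_pi fun i => by
      cases i using Fin.cases with
      | zero => exact continuous_const
      | succ i =>
        cases i using Fin.cases with
        | zero =>
          simp only [Fin.cons_succ, Fin.cons_zero]
          exact continuous_fst
        | succ i =>
          simp only [Fin.cons_succ]
          fun_prop)
  have := continuous_parametric_integral_of_continuous (μ := torusMeasure (N - 2)) hcons
    isCompact_univ
  simp only [Measure.restrict_univ] at this
  exact this.const_mul _

end Weight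

/-- The sum of `f (θ l - θ j)` over all ordered pairs of distinct indices. -/
def pairSum {N : ℕ} (f : Angle → ℂ) (θ : Fin N → Angle) : ℂ :=
  ∑ j, ∑ l ∈ Finset.univ.erase j, f (θ l - θ j)

section PairCorrelation

variable {β : ℝ} {N : ℕ} {f : Angle → ℂ}

lemma integrable_pair_mul_weight (hβ : 0 ≤ β) (hf : Continuous f) (j l : Fin N) :
    Integrable (fun θ : Fin N → Angle => f (θ l - θ j) * (weight β θ : ℂ)) (torusMeasure N) :=
  ((hf.comp ((continuous_apply l).sub (continuous_apply j))).mul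
    (Complex.continuous_ofReal.comp (continuous_weight hβ))).integrable_of_hasCompactSupport
      (.of_compactSpace _)

lemma integral_pairSum_mul_weight (hβ : 0 ≤ β) (hf : Continuous f) :
    ∫ θ : Fin N → Angle, pairSum f θ * (weight β θ : ℂ) ∂torusMeasure N =
      ∑ j, ∑ l ∈ Finset.univ.erase j,
        ∫ θ : Fin N → Angle, f (θ l - θ j) * (weight β θ : ℂ) ∂torusMeasure N := by
  simp only [pairSum, Finset.sum_mul]
  rw [integral_finsetSum _ fun j _ => integrable_finsetSum _ fun l _ =>
    integrable_pair_mul_weight hβ hf j l]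
  exact Finset.sum_congr rfl fun j _ => integral_finsetSum _ fun l _ =>
    integrable_pair_mul_weight hβ hf j l

lemma integral_pair_mul_weight_congr (β : ℝ) (f : Angle → ℂ) {j l j' l' : Fin N} (h : j ≠ l)
    (h' : j' ≠ l') : ∫ θ : Fin N → Angle, f (θ l - θ j) * (weight β θ : ℂ) ∂torusMeasure N =
      ∫ θ : Fin N → Angle, f (θ l' - θ j') * (weight β θ : ℂ) ∂torusMeasure N := by
  obtain ⟨σ, hj, hl⟩ := MulAction.is_two_pretransitive_iff.1
    (Equiv.Perm.isMultiplyPretransitive (Fin N) 2) h h'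
  rw [Equiv.Perm.smul_def] at hj hl
  rw [← integral_comp_perm σ fun θ => f (θ l - θ j) * (weight β θ : ℂ)]
  simp only [weight_comp_perm, Function.comp_apply, hj, hl]

lemma integral_mul_rho2 (hβ : 0 ≤ β) (hf : Continuous f) :
    ∫ x, f x * (rho2 β N 0 x : ℂ) ∂AddCircle.haarAddCircle =
      (∫ θ : Fin N → Angle, pairSum f θ * (weight β θ : ℂ) ∂torusMeasure N) /
        partitionFunction β N := by
  rcases N with _ | _ | n
  · simp [rho2, pairSum]
  · simp [rho2, pairSum]
  have hpair : ∫ x, f x * ((∫ φ, weight β (Fin.cons 0 (Fin.cons x φ : Fin (n + 1) → Angle) :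
      Fin (n + 2) → Angle) ∂torusMeasure n : ℝ) : ℂ) ∂AddCircle.haarAddCircle =
        ∫ θ : Fin (n + 2) → Angle, f (θ 1 - θ 0) * (weight β θ : ℂ) ∂torusMeasure (n + 2) := by
    have hf0 : Continuous fun φ : Fin (n + 1) → Angle => f (φ 0) := hf.comp (continuous_apply 0)
    have hint : Integrable (fun φ : Fin (n + 1) → Angle => f (φ 0) *
        (weight β (Fin.cons 0 φ : Fin (n + 2) → Angle) : ℂ)) (torusMeasure (n + 1)) :=
      (hf0.mul (Complex.continuous_ofReal.comp ((continuous_weight hβ).comp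
        (continuous_const.finCons continuous_id)))).integrable_of_hasCompactSupport
          (.of_compactSpace _)
    rw [← Fin.succ_zero_eq_one, integral_sub_mul_weight hβ hf0, integral_insertNth 0 hint]
    simp only [Fin.insertNth_zero', Fin.cons_zero, integral_const_mul, integral_complex_ofReal]
  have hsum : ∫ θ : Fin (n + 2) → Angle, pairSum f θ * (weight β θ : ℂ) ∂torusMeasure (n + 2) =
      (n + 2) * (n + 1) *
        ∫ θ : Fin (n + 2) → Angle, f (θ 1 - θ 0) * (weight β θ : ℂ) ∂torusMeasure (n + 2) := by
    rw [integral_pairSum_mul_weight hβ hf, Finset.sum_congr rfl fun j _ =>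
      Finset.sum_congr rfl fun l hl => integral_pair_mul_weight_congr β f
        (Finset.ne_of_mem_erase hl).symm (zero_ne_one : (0 : Fin (n + 2)) ≠ 1)]
    simp [mul_assoc]
  rw [hsum, ← hpair, ← integral_const_mul, ← integral_div]
  congr 1
  ext x
  rw [rho2_add_two]
  push_cast
  ring

lemma moment_eq (hβ : 0 ≤ β) (N : ℕ) (k : ℤ) :
    moment β N k = (∫ θ : Fin N → Angle, pairSum (fourier (-k)) θ * (weight β θ : ℂ)
      ∂torusMeasure N) / partitionFunction β N - if k = 0 then (N : ℂ) ^ 2 else 0 := by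
  have hint : Integrable (fun x : Angle => fourier (-k) x * (rho2 β N 0 x : ℂ))
      AddCircle.haarAddCircle :=
    ((map_continuous (fourier (-k))).mul (Complex.continuous_ofReal.comp
      (continuous_rho2 hβ N))).integrable_of_hasCompactSupport (.of_compactSpace _)
  have hint' : Integrable (fun x : Angle => fourier (-k) x * (N : ℂ) ^ 2)
      AddCircle.haarAddCircle :=
    ((map_continuous (fourier (-k))).mul continuous_const).integrable_of_hasCompactSupport
      (.of_compactSpace _)
  simp only [moment, fourierCoeff, rho2C, rho1_eq hβ, smul_eq_mul]
  push_cast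
  simp only [mul_sub, ← sq]
  rw [integral_sub hint hint', integral_mul_rho2 hβ (map_continuous _), integral_mul_const,
    integral_fourier]
  simp only [neg_eq_zero, ite_mul, one_mul, zero_mul]

lemma moment_zero (hβ : 0 ≤ β) (N : ℕ) : moment β N 0 = -N := by
  have hZ : (partitionFunction β N : ℂ) ≠ 0 := by exact_mod_cast (partitionFunction_pos hβ N).ne'
  have hsum (θ : Fin N → Angle) : pairSum (fourier (-0)) θ = N * (N - 1) := by
    rcases N with _ | n <;> simp [pairSum]
  rw [moment_eq hβ]
  simp only [hsum, integral_const_mul, integral_complex_ofReal, if_true]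
  rw [← partitionFunction, mul_div_cancel_right₀ _ hZ]
  ring

lemma pairSum_comp_neg (f : Angle → ℂ) (θ : Fin N → Angle) :
    pairSum (fun x => f (-x)) θ = pairSum f θ := by
  simp only [pairSum, neg_sub]
  exact Finset.sum_comm' fun j l => by simp [ne_comm]

lemma moment_neg (hβ : 0 ≤ β) (N : ℕ) (k : ℤ) : moment β N (-k) = moment β N k := by
  have hsum (θ : Fin N → Angle) : pairSum (fourier (- -k)) θ = pairSum (fourier (-k)) θ := by
    rw [← pairSum_comp_neg (fourier (-k))]
    congr 1
    ext x
    simp only [fourier_apply, neg_smul, smul_neg]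
  simp only [moment_eq hβ, hsum, neg_eq_zero]

end PairCorrelation

/-! ### The weight at `β = 1` -/

lemma abs_sin_div_two {x : ℝ} (hx : |x| ≤ 2 * π) :
    |Real.sin (x / 2)| = x.sign * Real.sin (x / 2) := by
  rw [abs_le] at hx
  rcases lt_trichotomy x 0 with h | rfl | h
  · rw [Real.sign_of_neg h, neg_one_mul,
      abs_of_nonpos (Real.sin_nonpos_of_nonpos_of_neg_pi_le (by linarith) (by linarith))]
  · simp
  · rw [Real.sign_of_pos h, one_mul,
      abs_of_nonneg (Real.sin_nonneg_of_nonneg_of_le_pi (by linarith) (by linarith))]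

lemma toCircle_sub_mul_planeWave (x y : Angle) :
    ((y.toCircle : ℂ) - (x.toCircle : ℂ)) * (planeWave (-1 / 2) x * planeWave (-1 / 2) y) =
      2 * Complex.I * (Real.sin ((rep y - rep x) / 2) : ℂ) := by
  rw [toCircle_eq_planeWave, toCircle_eq_planeWave, sub_mul, Complex.ofReal_sin, Complex.sin]
  simp only [planeWave, ← Complex.exp_add]
  push_cast
  ring_nf
  simp only [Complex.I_sq]
  ring

lemma norm_toCircle_sub (x y : Angle) :
    (‖(x.toCircle : ℂ) - (y.toCircle : ℂ)‖ : ℂ) =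
      Complex.I * ((rep x - rep y).sign : ℂ) *
        ((y.toCircle : ℂ) - (x.toCircle : ℂ)) * (planeWave (-1 / 2) x * planeWave (-1 / 2) y) := by
  have hrep : |rep y - rep x| ≤ 2 * π := by
    have hx := rep_mem_Ioc x
    have hy := rep_mem_Ioc y
    rw [abs_le]
    constructor <;> linarith [hx.1, hx.2, hy.1, hy.2]
  have hnorm : ‖(x.toCircle : ℂ) - (y.toCircle : ℂ)‖ = 2 * |Real.sin ((rep y - rep x) / 2)| := by
    simpa [norm_planeWave, norm_sub_rev, -Complex.ofReal_sin] using
      congrArg norm (toCircle_sub_mul_planeWave x y)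
  rw [mul_assoc, toCircle_sub_mul_planeWave, hnorm, abs_sin_div_two hrep,
    ← neg_sub (rep y) (rep x), Real.sign_neg]
  push_cast
  linear_combination (2 * ((rep y - rep x).sign : ℂ) * Complex.sin ((rep y - rep x) / 2)) *
    Complex.I_sq

lemma prod_prod_Ioi_mul {M : Type*} [CommMonoid M] {N : ℕ} (w : Fin N → M) :
    ∏ j : Fin N, ∏ k ∈ Finset.Ioi j, (w j * w k) = ∏ j, w j ^ (N - 1) := by
  simp only [Finset.prod_mul_distrib, Finset.prod_const]
  rw [Finset.prod_comm' (t' := Finset.univ) (s' := fun k => Finset.Iio k) (by simp)]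
  simp only [Finset.prod_const]
  rw [← Finset.prod_mul_distrib]
  refine Finset.prod_congr rfl fun j _ => ?_
  rw [← pow_add, Fin.card_Ioi, Fin.card_Iio]
  congr 1
  have := j.2
  omega

lemma planeWave_pow (q : ℝ) (x : Angle) (n : ℕ) : planeWave q x ^ n = planeWave (n * q) x := by
  rw [planeWave, planeWave, ← Complex.exp_nat_mul]
  push_cast
  ring_nf

lemma det_planeWave_frequency {N : ℕ} (θ : Fin N → Angle) :
    (Matrix.of fun j a : Fin N => planeWave (frequency N a) (θ j)).det =
      (∏ j, ∏ k ∈ Finset.Ioi j, ((θ k).toCircle - (θ j).toCircle : ℂ)) *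
        ∏ j, ∏ k ∈ Finset.Ioi j, (planeWave (-1 / 2) (θ j) * planeWave (-1 / 2) (θ k)) := by
  rw [← Matrix.det_vandermonde fun j => ((θ j).toCircle : ℂ), prod_prod_Ioi_mul, mul_comm,
    ← Matrix.det_mul_column]
  congr 1
  ext j a
  have hN : ((N - 1 : ℕ) : ℝ) = N - 1 := by
    rw [Nat.cast_sub (by have := a.2; omega), Nat.cast_one]
  rw [Matrix.of_apply, Matrix.of_apply, Matrix.vandermonde_apply, toCircle_eq_planeWave,
    planeWave_pow, planeWave_pow, ← planeWave_add, hN, frequency]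
  congr 1
  push_cast
  ring

lemma orderSign_mul_det_planeWave {N : ℕ} (q : Fin N → ℝ) (θ : Fin N → Angle) :
    (orderSign (rep ∘ θ) : ℂ) * (Matrix.of fun j a : Fin N => planeWave (q a) (θ j)).det =
      ∑ σ : Equiv.Perm (Fin N), orderedWave q (θ ∘ σ) := by
  rw [Matrix.det_apply, Finset.mul_sum]
  refine Finset.sum_congr rfl fun σ _ => ?_
  simp only [orderedWave, ← Function.comp_assoc, orderSign_comp_perm, Matrix.of_apply,
    Units.smul_def, zsmul_eq_mul, Function.comp_apply]
  push_cast
  ring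

lemma exists_weight_one_eq (N : ℕ) : ∃ κ : ℂ, ∀ θ : Fin N → Angle, (weight 1 θ : ℂ) =
    κ * ∑ σ : Equiv.Perm (Fin N), orderedWave (frequency N ∘ ((↑) : Fin N → ℤ)) (θ ∘ σ) := by
  refine ⟨∏ j : Fin N, ∏ _k ∈ Finset.Ioi j, Complex.I, fun θ => ?_⟩
  rw [← orderSign_mul_det_planeWave]
  simp only [Function.comp_apply, det_planeWave_frequency, orderSign, weight]
  push_cast
  simp only [Real.rpow_one, norm_toCircle_sub, Finset.prod_mul_distrib]
  ring

lemma exists_integral_mul_weight_one (N : ℕ) : ∃ κ : ℂ, ∀ g : (Fin N → Angle) → ℂ,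
    Continuous g → (∀ σ : Equiv.Perm (Fin N), ∀ θ, g (θ ∘ σ) = g θ) →
      ∫ θ, g θ * (weight 1 θ : ℂ) ∂torusMeasure N =
        κ * ∫ θ, g θ * orderedWave (frequency N ∘ ((↑) : Fin N → ℤ)) θ ∂torusMeasure N := by
  obtain ⟨κ, hκ⟩ := exists_weight_one_eq N
  refine ⟨κ * (N.factorial : ℂ), fun g hg hsymm => ?_⟩
  set w := orderedWave (frequency N ∘ ((↑) : Fin N → ℤ))
  have hint (σ : Equiv.Perm (Fin N)) :
      Integrable (fun θ => g (θ ∘ σ) * w (θ ∘ σ)) (torusMeasure N) :=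
    ((hg.comp (by fun_prop)).integrable_of_hasCompactSupport (.of_compactSpace _)).mul_bdd
      (c := 1) ((measurable_orderedWave _).comp (by fun_prop)).aestronglyMeasurable
      (.of_forall fun θ => norm_orderedWave_le_one _ _)
  have hexpand (θ : Fin N → Angle) : g θ * (weight 1 θ : ℂ) =
      κ * ∑ σ : Equiv.Perm (Fin N), g (θ ∘ σ) * w (θ ∘ σ) := by
    simp only [hκ, hsymm, ← Finset.mul_sum]
    ring
  simp only [hexpand]
  rw [integral_const_mul, integral_finsetSum _ fun σ _ => hint σ]
  simp only [integral_comp_perm _ fun θ => g θ * w θ]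
  simp [Fintype.card_perm, mul_assoc]

lemma continuous_pairSum {N : ℕ} {f : Angle → ℂ} (hf : Continuous f) :
    Continuous (pairSum f : (Fin N → Angle) → ℂ) :=
  continuous_finsetSum _ fun j _ => continuous_finsetSum _ fun l _ =>
    hf.comp ((continuous_apply l).sub (continuous_apply j))

lemma pairSum_comp_perm {N : ℕ} (f : Angle → ℂ) (σ : Equiv.Perm (Fin N)) (θ : Fin N → Angle) :
    pairSum f (θ ∘ σ) = pairSum f θ := by
  rw [pairSum, pairSum, ← Equiv.sum_comp σ fun j => ∑ l ∈ Finset.univ.erase j, f (θ l - θ j)]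
  exact Finset.sum_congr rfl fun j _ => Finset.sum_equiv σ (by simp) fun _ _ => rfl

lemma fourier_mul_orderedWave {N : ℕ} (k : ℤ) (a b : Fin N) (θ : Fin N → Angle) :
    fourier (-k) (θ b - θ a) * orderedWave (frequency N ∘ ((↑) : Fin N → ℤ)) θ =
      orderedWave (frequency N ∘ shift k a b) θ := by
  have hfreq (i : Fin N) : frequency N (shift k a b i) =
      frequency N i + (if i = a then (k : ℝ) else 0) + (if i = b then (-k : ℝ) else 0) := by
    simp only [frequency, shift]
    split_ifs <;> push_cast <;> ring
  have hwave (c : Fin N) (q : ℝ) :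
      ∏ i, planeWave (if i = c then q else 0) (θ i) = planeWave q (θ c) := by
    rw [Finset.prod_eq_single c (fun i _ hi => by rw [if_neg hi, planeWave_zero]) (by simp),
      if_pos rfl]
  have hfourier : fourier (-k) (θ b - θ a) = planeWave k (θ a) * planeWave (-k) (θ b) := by
    rw [← Int.cast_neg, ← fourier_eq_planeWave, ← fourier_eq_planeWave]
    simp [fourier_apply, sub_eq_neg_add, AddCircle.toCircle_add]
  simp only [orderedWave, Function.comp_apply, hfreq, planeWave_add, Finset.prod_mul_distrib,
    hwave, hfourier]
  ring

lemma moment_one_eq_sum {k : ℕ} (hk : k ≠ 0) (N : ℕ) :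
    moment 1 N k = ((∑ a ∈ Finset.range N, rowMoment N k a : ℝ) : ℂ) := by
  obtain ⟨κ, hκ⟩ := exists_integral_mul_weight_one N
  have hZ : (partitionFunction 1 N : ℂ) =
      κ * orderedIntegral (frequency N ∘ ((↑) : Fin N → ℤ)) := by
    simpa [integral_complex_ofReal, orderedIntegral, partitionFunction] using
      hκ (fun _ => 1) continuous_const fun _ _ => rfl
  have hZ0 := hZ ▸ Complex.ofReal_ne_zero.2 (partitionFunction_pos zero_le_one N).ne'
  have hrow : ∫ θ, pairSum (fourier (-k)) θ * orderedWave (frequency N ∘ ((↑) : Fin N → ℤ)) θ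
      ∂torusMeasure N = (∑ a ∈ Finset.range N, rowMoment N k a : ℝ) *
        orderedIntegral (frequency N ∘ ((↑) : Fin N → ℤ)) := by
    simp only [pairSum, Finset.sum_mul, fourier_mul_orderedWave]
    rw [integral_finsetSum _ fun _ _ => integrable_finsetSum _ fun _ _ => integrable_orderedWave _]
    simp only [integral_finsetSum _ fun _ _ => integrable_orderedWave _]
    push_cast
    rw [← Fin.sum_univ_eq_sum_range (fun a => (rowMoment N k a : ℂ)), Finset.sum_mul]
    exact Finset.sum_congr rfl fun a _ => sum_orderedIntegral_shift hk a
  rw [moment_eq zero_le_one, hκ _ (continuous_pairSum (map_continuous _)) (pairSum_comp_perm _),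
    hrow, hZ, if_neg (by exact_mod_cast hk), sub_zero, mul_left_comm, mul_div_cancel_right₀ _ hZ0]

/-! ### Closed forms of the moments -/

section ClosedForm

variable (N k i : ℕ)

lemma frequency_sub_add_add :
    frequency N ((N - k + i : ℕ) : ℤ) + k = ((N : ℝ) + 1) / 2 + (k - N : ℕ) + i := by
  have hcast : ((N - k : ℕ) : ℝ) + k = N + (k - N : ℕ) := by
    exact_mod_cast (by omega : N - k + k = N + (k - N))
  rw [frequency]
  push_cast
  linear_combination hcast

lemma frequency_sub_add_add_pos : 0 < frequency N ((N - k + i : ℕ) : ℤ) + k := by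
  rw [frequency_sub_add_add]
  positivity

lemma sum_rowMoment : ∑ a ∈ Finset.range N, rowMoment N k a =
    -((N - k : ℕ) : ℝ) + ∑ i ∈ Finset.range (min k N),
      frequency N ((N - k + i : ℕ) : ℤ) / (frequency N ((N - k + i : ℕ) : ℤ) + k) := by
  have hswap : ∀ a ∈ Finset.range (N - k), rowMoment N k a = -1 := fun a ha =>
    if_pos (by rw [Finset.mem_range] at ha; omega)
  have hrev (i : ℕ) : rowMoment N k (N - k + i) =
      frequency N ((N - k + i : ℕ) : ℤ) / (frequency N ((N - k + i : ℕ) : ℤ) + k) := by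
    rw [rowMoment, if_neg (by omega)]
    simp only [frequency]
    push_cast
    ring_nf
  conv_lhs => rw [show N = (N - k) + min k N by omega, Finset.sum_range_add]
  rw [← show N = (N - k) + min k N by omega]
  simp [Finset.sum_congr rfl hswap, hrev]

lemma sum_rowMoment_eq_sum_inv : ∑ a ∈ Finset.range N, rowMoment N k a =
    -((N - k : ℕ) : ℝ) + (min k N : ℕ) -
      k * ∑ i ∈ Finset.range (min k N), 1 / (((N : ℝ) + 1) / 2 + (k - N : ℕ) + i) := by
  have hterm (i : ℕ) : frequency N ((N - k + i : ℕ) : ℤ) /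
      (frequency N ((N - k + i : ℕ) : ℤ) + k) =
        1 - k * (1 / (((N : ℝ) + 1) / 2 + (k - N : ℕ) + i)) := by
    rw [← frequency_sub_add_add, mul_one_div,
      eq_sub_iff_add_eq, ← add_div, div_self (frequency_sub_add_add_pos N k i).ne']
  simp only [sum_rowMoment, hterm, Finset.sum_sub_distrib, ← Finset.mul_sum, Finset.sum_const,
    Finset.card_range, nsmul_eq_mul, mul_one]
  ring

end ClosedForm

lemma digamma_add_natCast_sub {s : ℂ} (hs : ∀ j : ℕ, s ≠ -j) (m : ℕ) :
    Complex.digamma (s + m) - Complex.digamma s = ∑ i ∈ Finset.range m, 1 / (s + i) := by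
  induction m with
  | zero => simp
  | succ m ih =>
    have hm (j : ℕ) : s + m ≠ -j := fun h => hs (m + j) (by
      push_cast
      linear_combination h)
    rw [Finset.sum_range_succ, ← ih, Nat.cast_succ, ← add_assoc,
      Complex.digamma_apply_add_one _ hm]
    ring

lemma sum_rowMoment_eq_digamma (N k : ℕ) :
    ((∑ a ∈ Finset.range N, rowMoment N k a : ℝ) : ℂ) =
      -((N - k : ℕ) : ℂ) - (-((min k N : ℕ) : ℂ) +
        k * (Complex.digamma (((N : ℂ) + 1) / 2 + k) -
          Complex.digamma (((N : ℂ) + 1) / 2 + (k - N : ℕ)))) := by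
  have hs (j : ℕ) : ((N : ℂ) + 1) / 2 + (k - N : ℕ) ≠ -j := by
    rw [ne_eq, ← add_eq_zero_iff_eq_neg]
    have : ((N : ℝ) + 1) / 2 + (k - N : ℕ) + j ≠ 0 := by positivity
    simpa only [ne_eq, Complex.ofReal_eq_zero, Complex.ofReal_add, Complex.ofReal_div,
      Complex.ofReal_natCast, Complex.ofReal_one, Complex.ofReal_ofNat] using
      Complex.ofReal_ne_zero.2 this
  have hk : ((k - N : ℕ) : ℂ) + (min k N : ℕ) = k := by
    exact_mod_cast (by omega : k - N + min k N = k)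
  have h := digamma_add_natCast_sub hs (min k N)
  rw [add_assoc, hk] at h
  rw [h, sum_rowMoment_eq_sum_inv]
  push_cast [-Nat.cast_min]
  ring

lemma sum_rowMoment_eq_partialFraction {N k : ℕ} (hk : k ≤ N + 1) :
    ∑ a ∈ Finset.range N, rowMoment N k a =
      -(N : ℝ) + 2 * k - 2 * k * ∑ j ∈ Finset.Icc 1 k, 1 / ((N : ℝ) + 2 * j - 1) := by
  have hsum : 2 * ∑ j ∈ Finset.Icc 1 k, 1 / ((N : ℝ) + 2 * j - 1) =
      ∑ i ∈ Finset.range k, 1 / (((N : ℝ) + 1) / 2 + i) := by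
    rw [← Finset.Ico_add_one_right_eq_Icc, Finset.sum_Ico_eq_sum_range, Finset.mul_sum]
    refine Finset.sum_congr (by simp) fun i _ => ?_
    have hden : (N : ℝ) + 2 * ((1 + i : ℕ) : ℝ) - 1 = 2 * (((N : ℝ) + 1) / 2 + i) := by
      push_cast
      ring
    rw [hden]
    field_simp
  rw [mul_comm (2 : ℝ) k, mul_assoc, hsum, sum_rowMoment_eq_sum_inv]
  rcases Nat.le_succ_iff.1 hk with hk | rfl
  · rw [min_eq_left hk, Nat.sub_eq_zero_of_le hk, Nat.cast_sub hk]
    simp only [Nat.cast_zero, add_zero]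
    ring
  · have hfirst : ((N : ℝ) + 1) * (1 / (((N : ℝ) + 1) / 2)) = 2 := by field_simp
    rw [min_eq_right N.le_succ, Nat.sub_eq_zero_of_le N.le_succ, Finset.sum_range_succ' _ N]
    simp only [Nat.succ_sub N.le_refl, Nat.sub_self, add_right_comm]
    push_cast
    simp only [← add_assoc, add_zero, mul_add, hfirst]
    ring

lemma sum_frequency_range (N m a : ℕ) : ∑ i ∈ Finset.range m, frequency N ((a + i : ℕ) : ℤ) =
    m * (2 * a + m - N) / 2 := by
  induction m with
  | zero => simp
  | succ m ih =>
    rw [Finset.sum_range_succ, ih, frequency]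
    push_cast
    ring

lemma div_add_le_div {x y : ℝ} (hy : 0 < y) (hxy : 0 < x + y) : x / (x + y) ≤ x / y := by
  rw [div_le_div_iff₀ hxy hy]
  nlinarith [sq_nonneg x]

lemma div_add_lt_div {x y : ℝ} (hx : x ≠ 0) (hy : 0 < y) (hxy : 0 < x + y) :
    x / (x + y) < x / y := by
  rw [div_lt_div_iff₀ hxy hy]
  nlinarith [sq_pos_of_ne_zero hx]

lemma sum_rowMoment_neg {N k : ℕ} (hN : 2 ≤ N) (hk : k ≠ 0) :
    ∑ a ∈ Finset.range N, rowMoment N k a < 0 := by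
  have hk0 : (0 : ℝ) < k := by positivity
  have hlast : frequency N ((N - k + (min k N - 1) : ℕ) : ℤ) ≠ 0 := by
    obtain ⟨n, rfl⟩ : ∃ n, N = n + 2 := Nat.exists_eq_add_of_le' hN
    exact frequency_ne_zero (n := n + 1) (by omega)
  have hlt : ∑ i ∈ Finset.range (min k N), frequency N ((N - k + i : ℕ) : ℤ) /
      (frequency N ((N - k + i : ℕ) : ℤ) + k) <
        ∑ i ∈ Finset.range (min k N), frequency N ((N - k + i : ℕ) : ℤ) / k :=
    Finset.sum_lt_sum (fun i _ => div_add_le_div hk0 (frequency_sub_add_add_pos N k i))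
      ⟨min k N - 1, Finset.mem_range.2 (by omega),
        div_add_lt_div hlast hk0 (frequency_sub_add_add_pos N k _)⟩
  have hmean : ∑ i ∈ Finset.range (min k N), frequency N ((N - k + i : ℕ) : ℤ) / k ≤
      ((N - k : ℕ) : ℝ) / 2 := by
    have hsplit : ((N - k : ℕ) : ℝ) + (min k N : ℕ) = N := by
      exact_mod_cast (by omega : N - k + min k N = N)
    have hmin : ((min k N : ℕ) : ℝ) ≤ k := by exact_mod_cast min_le_left k N
    rw [← Finset.sum_div, sum_frequency_range, div_le_iff₀ hk0, ← hsplit]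
    nlinarith [mul_le_mul_of_nonneg_right hmin ((N - k).cast_nonneg : (0 : ℝ) ≤ (N - k : ℕ))]
  rw [sum_rowMoment]
  linarith [((N - k).cast_nonneg : (0 : ℝ) ≤ (N - k : ℕ))]

lemma moment_one_ne_zero {N : ℕ} (hN : 2 ≤ N) (k : ℤ) : moment 1 N k ≠ 0 := by
  have hnat (k : ℕ) : moment 1 N k ≠ 0 := by
    rcases eq_or_ne k 0 with rfl | hk
    · rw [Nat.cast_zero, moment_zero zero_le_one, neg_ne_zero, Nat.cast_ne_zero]
      omega
    · rw [moment_one_eq_sum hk, Complex.ofReal_ne_zero]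
      exact (sum_rowMoment_neg hN hk).ne
  obtain ⟨k, rfl | rfl⟩ := k.eq_nat_or_neg
  · exact hnat k
  · exact moment_neg zero_le_one N k ▸ hnat k

lemma moment_one_eq_digamma {N : ℕ} {k : ℤ} (hk : 1 ≤ k) :
    moment 1 N k = -((max ((N : ℤ) - |k|) 0 : ℤ) : ℂ) - (-((min k (N : ℤ) : ℤ) : ℂ) +
      (k : ℂ) * (Complex.digamma (((N : ℂ) + 1) / 2 + (k : ℂ)) -
        Complex.digamma (((N : ℂ) + 1) / 2 + ((max 0 (k - (N : ℤ)) : ℤ) : ℂ)))) := by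
  lift k to ℕ using by omega
  have hmax : max ((N : ℤ) - |(k : ℤ)|) 0 = ((N - k : ℕ) : ℤ) := by
    rw [Nat.abs_cast]
    omega
  have hmax' : max 0 ((k : ℤ) - N) = ((k - N : ℕ) : ℤ) := by omega
  rw [moment_one_eq_sum (by omega), sum_rowMoment_eq_digamma, hmax, hmax', ← Nat.cast_min]
  simp only [Int.cast_natCast]

end CircularEnsemble

end

theorem proposition5p3 (N : ℕ) (hN : 1 ≤ N) :
    -- the explicit formulae
    CircularEnsemble.moment 1 N 0 = -(N : ℂ) ∧
    (∀ k : ℤ, 1 ≤ k →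
      CircularEnsemble.moment 1 N k =
        -((max ((N : ℤ) - |k|) 0 : ℤ) : ℂ) -
          (-((min k (N : ℤ) : ℤ) : ℂ) +
            (k : ℂ) * (Complex.digamma (((N : ℂ) + 1) / 2 + (k : ℂ)) -
              Complex.digamma (((N : ℂ) + 1) / 2 + ((max 0 (k - (N : ℤ)) : ℤ) : ℂ))))) ∧
    (∀ k : ℤ, k ≤ -1 →
      CircularEnsemble.moment 1 N k =
        -((max ((N : ℤ) - |k|) 0 : ℤ) : ℂ) -
          (-((min (-k) (N : ℤ) : ℤ) : ℂ) -
            (k : ℂ) * (Complex.digamma (((N : ℂ) + 1) / 2 - (k : ℂ)) -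
              Complex.digamma (((N : ℂ) + 1) / 2 + ((max 0 (-k - (N : ℤ)) : ℤ) : ℂ))))) ∧
    -- no moment vanishes
    (2 ≤ N → ∀ k : ℤ, CircularEnsemble.moment 1 N k ≠ 0) ∧
    -- the partial fraction form
    (∀ k : ℕ, 1 ≤ k → k ≤ N + 1 →
      CircularEnsemble.moment 1 N (k : ℤ) =
        -(N : ℂ) + 2 * (k : ℂ) -
          2 * (k : ℂ) * ∑ j ∈ Finset.Icc 1 k, 1 / ((N : ℂ) + 2 * (j : ℂ) - 1)) := by
  refine ⟨CircularEnsemble.moment_zero zero_le_one N,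
    fun k hk => CircularEnsemble.moment_one_eq_digamma hk, fun k hk => ?_,
    CircularEnsemble.moment_one_ne_zero, fun k hk hkN => ?_⟩
  · rw [← CircularEnsemble.moment_neg zero_le_one,
      CircularEnsemble.moment_one_eq_digamma (by omega)]
    simp only [abs_neg, Int.cast_neg, neg_mul, ← sub_eq_add_neg]
  · rw [CircularEnsemble.moment_one_eq_sum (by omega),
      CircularEnsemble.sum_rowMoment_eq_partialFraction hkN]
    push_cast
    rfl
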